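/- **Setting.** There are $n$ buyers $[n]$ and $m$ items $[m]$. Buyer $i$ has a valuation $v_i : 2^{[m]} \to \mathbb{R}_{\ge 0}$ with $v_i(\emptyset)=0$ that is monotone ($v_i(S)\le v_i(T)$ for $S\subseteq T$). The valuation $v_i$ is *submodular* if $v_i(A\cup\{j\})-v_i(A)\ge v_i(B\cup\{j\})-v_i(B)$ for all $A\subseteq B\subseteq[m]$ and $j\in[m]\setminus B$, and *XOS* if there are finitely many additive functions $a_1,\dots,a_k$ with nonnegative item values such that $v_i(B)=\max_{\ell}\sum_{j\in B}a_\ell(j)$ for all $B\subseteq[m]$. Let $\mathrm{OPT}(\mathbf v)$ be the maximum of $\sum_{i\in[n]} v_i(A_i)$ over all families of pairwise disjoint bundles $A_1,\dots,A_n\subseteq[m]$. An *order-oblivious secretary algorithm* knows $n$ and $m$ and may be randomized. It fixes a (possibly random) sample size $k\in\{0,\dots,n\}$; then a uniformly random set $S\subseteq[n]$ of $k$ buyers is drawn and the valuations $v_i$, $i\in S$, are revealed to the algorithm. Sampled buyers receive nothing. The buyers in $[n]\setminus S$ then arrive one by one in an adversarial order. When a buyer arrives, its identity and valuation are revealed,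 and the algorithm immediately and irrevocably gives it a bundle of items not allocated so far, depending only on its own random choices, the sample, and the arrivals up to and including this one. The algorithm is *$\alpha$-competitive* for submodular and XOS buyers if for every profile $\mathbf v$ in which each $v_i$ is submodular or XOS, and for every arrival order of the unsampled buyers (which may depend on $\mathbf v$, on $S$ and on the random choices of the algorithm), its expected welfare is at least $\frac1\alpha\,\mathrm{OPT}(\mathbf v)$. **Statement.** There is an absolute constant $\alpha\ge 1$ such that for all $n$ and $m$ there is an $\alpha$-competitive order-oblivious secretary algorithm for online combinatorial allocation with $n$ submodular or XOS buyers and $m$ items. Moreover, the algorithm samples a constant fraction of the buyers, in the sense that its sample size is distributed as $\mathrm{Binomial}(n,1/2)$, i.e. each buyer belongs to the sample independently with probability $1/2$. -/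

import Mathlib

namespace OrderObliviousSecretary

/-- A normalized monotone valuation on bundles of the items `Fin m`
(hence with nonnegative values). -/
structure Valuation (m : ℕ) where
  val : Finset (Fin m) → ℝ
  val_empty : val ∅ = 0
  mono : ∀ ⦃S T : Finset (Fin m)⦄, S ⊆ T → val S ≤ val T

/-- `v` is XOS: a pointwise maximum of a finite collection of nonnegative additive functions. -/
def Valuation.IsXOS {m : ℕ} (v : Valuation m) : Prop :=
  ∃ (k : ℕ) (a : Fin k → Fin m → ℝ), (∀ l j, 0 ≤ a l j) ∧
    ∀ B : Finset (Fin m), IsGreatest (Set.range fun l => ∑ j ∈ B, a l j) (v.val B)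

/-- `v` is submodular: decreasing marginal values. -/
def Valuation.IsSubmodular {m : ℕ} (v : Valuation m) : Prop :=
  ∀ A B : Finset (Fin m), A ⊆ B → ∀ j, j ∉ B →
    v.val (insert j B) - v.val B ≤ v.val (insert j A) - v.val A

/-- Assignments of pairwise disjoint bundles to the buyers `Fin n`. -/
def Allocation (n m : ℕ) : Type :=
  {A : Fin n → Finset (Fin m) // ∀ i j, i ≠ j → Disjoint (A i) (A j)}

/-- The offline optimal welfare (a supremum over a finite nonempty set, hence a maximum). -/
noncomputable def optWelfare {n m : ℕ} (v : Fin n → Valuation m) : ℝ :=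
  ⨆ A : Allocation n m, ∑ i, (v i).val (A.1 i)

/-- An arrival: the buyer together with the valuation it reveals. -/
abbrev Arrival (n m : ℕ) : Type := Fin n × Valuation m

/-- A randomized order-oblivious secretary algorithm for `n` buyers and `m` items.
It draws a seed, which fixes the sample size. After it has seen the valuations of a sample of that
size (`obs i = some (v i)` for the sampled buyers, `none` for the others), `request` gives the
bundle it selects for the currently arriving buyer, as a function of the seed, the sample, the
earlier arrivals (most recent first) and the current arrival only. -/
structure Algorithm (n m : ℕ) where
  Seed : Type
  [fintypeSeed : Fintype Seed]
  prob : Seed → ℝ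
  prob_nonneg : ∀ ω, 0 ≤ prob ω
  prob_sum : ∑ ω, prob ω = 1
  sampleSize : Seed → ℕ
  sampleSize_le : ∀ ω, sampleSize ω ≤ n
  request : Seed → (obs : Fin n → Option (Valuation m)) → (past : List (Arrival n m)) →
    (current : Arrival n m) → Finset (Fin m)

attribute [instance] Algorithm.fintypeSeed

namespace Algorithm

variable {n m : ℕ} (alg : Algorithm n m)

/-- The items allocated during a list of arrivals (most recent first). -/
def taken (ω : alg.Seed) (obs : Fin n → Option (Valuation m)) :
    List (Arrival n m) → Finset (Fin m)
  | [] => ∅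
  | x :: past => taken ω obs past ∪ alg.request ω obs past x

/-- The bundle irrevocably allocated to the current arrival: the still available part of the
requested bundle. -/
def bundle (ω : alg.Seed) (obs : Fin n → Option (Valuation m)) (past : List (Arrival n m))
    (x : Arrival n m) : Finset (Fin m) :=
  alg.request ω obs past x \ alg.taken ω obs past

/-- The welfare collected during a list of arrivals (most recent first). -/
def welfare (ω : alg.Seed) (obs : Fin n → Option (Valuation m)) : List (Arrival n m) → ℝ
  | [] => 0
  | x :: past => welfare ω obs past + x.2.val (alg.bundle ω obs past x)

end Algorithm

/-- What the sample `S` reveals about the valuation profile `v`. -/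
def observe {n m : ℕ} (v : Fin n → Valuation m) (S : Finset (Fin n)) :
    Fin n → Option (Valuation m) :=
  fun i => if i ∈ S then some (v i) else none

/-- `L` lists the buyers outside the sample `S`, each once, in order of arrival. -/
def IsArrivalOrder {n : ℕ} (S : Finset (Fin n)) (L : List (Fin n)) : Prop :=
  L.Nodup ∧ ∀ i, i ∈ L ↔ i ∉ S

/-- The expected welfare on the profile `v`: the seed is drawn, then a uniformly random set `S` of
`sampleSize` buyers is revealed, and the buyers outside `S` arrive in the order `order ω S`. -/
noncomputable def expectedWelfare {n m : ℕ} (alg : Algorithm n m) (v : Fin n → Valuation m)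
    (order : alg.Seed → Finset (Fin n) → List (Fin n)) : ℝ :=
  ∑ ω, alg.prob ω *
    ((∑ S ∈ Finset.powersetCard (alg.sampleSize ω) Finset.univ,
        alg.welfare ω (observe v S) ((order ω S).map fun i => (i, v i)).reverse)
      / (n.choose (alg.sampleSize ω) : ℝ))

/-- `alg` is `α`-competitive on submodular and XOS buyers, against all valuations of all buyers
(including the sampled ones) and every arrival order of the unsampled buyers. The order may depend
on the valuations, on the sample and on the seed, which covers adaptive adversaries. -/
def IsCompetitive {n m : ℕ} (alg : Algorithm n m) (α : ℝ) : Prop :=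
  ∀ v : Fin n → Valuation m, (∀ i, (v i).IsSubmodular ∨ (v i).IsXOS) →
    ∀ order : alg.Seed → Finset (Fin n) → List (Fin n),
      (∀ ω S, IsArrivalOrder S (order ω S)) →
        optWelfare v ≤ α * expectedWelfare alg v order

/-- The sample size is distributed as `Binomial(n, 1/2)`: equivalently, every buyer is in the
sample independently with probability `1/2`. -/
def SamplesHalf {n m : ℕ} (alg : Algorithm n m) : Prop :=
  ∀ k : ℕ, (∑ ω, if alg.sampleSize ω = k then alg.prob ω else 0) = (n.choose k : ℝ) / 2 ^ n

end OrderObliviousSecretary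

/-! Besides the sample `S`, draw an independent uniform set `R` of buyers. The buyers in `R ∩ S`, in
index order, raise item prices: each takes a demanded bundle at the current prices and lifts every
price to at least its share in an additive support of that bundle. The support of buyer `i` at the
prices just before index `i` is its additive bid. Each item is then sold separately, among the
buyers outside `R`, to an unsampled one that outbids all sampled ones.

The analysis loses four factors. Each buyer lies in `R ∩ S` with probability 1/4, so these buyers
carry a quarter of the optimum in expectation. The final prices cover half of that
(`sum_val_le_two_mul_sum_price`), and each price is at most the largest bid on its item. A bid
depends only on smaller indices in `R ∩ S`, so for fixed `S` discarding the bidders in `R` costs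
another factor 2 (`sum_runningMax_le`). For fixed `R` the bids depend on `S ∩ R` only, so the sample
outside `R` is fresh randomness: with probability at least 1/4 the top bidder is unsampled and the
runner-up, if any, is sampled (`sum_max_le_four_mul_soleWinnerValue`). The top bidder is then the
only possible taker of the item, whatever the arrival order. Altogether 4 · 2 · 2 · 4 = 64. -/

open Finset

namespace OrderObliviousSecretary

/-! ### Averaging over random sets by toggling one element -/

section Toggling

variable {α : Type*} [Fintype α] [DecidableEq α]

/-- Toggling an element `e S` that is itself unaffected by the toggling is an involution, so an
invariant function has at least half of its mass on the sets not containing `e S`. -/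
theorem sum_le_two_mul_sum_not_mem (e : Finset α → α) (f : Finset α → ℝ)
    (he : ∀ S, e (symmDiff S {e S}) = e S) (hf : ∀ S, f (symmDiff S {e S}) = f S) :
    ∑ S, f S ≤ 2 * ∑ S, (if e S ∉ S then f S else 0) := by
  have hinv : Function.Involutive (fun S : Finset α => symmDiff S {e S}) := fun S => by
    simp only [he, symmDiff_symmDiff_cancel_right]
  have hsum : ∑ S, (if e S ∉ S then f S else 0) =
      ∑ S, (if e (symmDiff S {e S}) ∉ symmDiff S {e S} then f (symmDiff S {e S}) else 0) :=
    (Equiv.sum_comp hinv.toPerm (fun S => if e S ∉ S then f S else 0)).symm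
  rw [two_mul]
  nth_rewrite 2 [hsum]
  rw [← sum_add_distrib]
  refine sum_le_sum fun S _ => ?_
  rw [he, hf]
  by_cases h : e S ∈ S <;> simp [h, mem_symmDiff]

/-- As `sum_le_two_mul_sum_not_mem`, for the sets containing `e S`. -/
theorem sum_le_two_mul_sum_mem (e : Finset α → α) (f : Finset α → ℝ)
    (he : ∀ S, e (symmDiff S {e S}) = e S) (hf : ∀ S, f (symmDiff S {e S}) = f S) :
    ∑ S, f S ≤ 2 * ∑ S, (if e S ∈ S then f S else 0) := by
  have hinv : Function.Involutive (fun S : Finset α => symmDiff S {e S}) := fun S => by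
    simp only [he, symmDiff_symmDiff_cancel_right]
  have hsum : ∑ S, (if e S ∈ S then f S else 0) =
      ∑ S, (if e (symmDiff S {e S}) ∈ symmDiff S {e S} then f (symmDiff S {e S}) else 0) :=
    (Equiv.sum_comp hinv.toPerm (fun S => if e S ∈ S then f S else 0)).symm
  rw [two_mul]
  nth_rewrite 2 [hsum]
  rw [← sum_add_distrib]
  refine sum_le_sum fun S _ => ?_
  rw [he, hf]
  by_cases h : e S ∈ S <;> simp [h, mem_symmDiff]

end Toggling

/-! ### Running maxima and random deletion -/

section RunningMax

variable {n : ℕ}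

/-- The maximum of `0` and the values `x i` with `i < t`. -/
noncomputable def runningMax (x : Fin n → ℝ) : ℕ → ℝ
  | 0 => 0
  | t + 1 => if h : t < n then max (runningMax x t) (x ⟨t, h⟩) else runningMax x t

theorem runningMax_succ (x : Fin n → ℝ) (i : Fin n) :
    runningMax x (i + 1) = max (runningMax x i) (x i) := by
  simp [runningMax]

theorem runningMax_mono {x y : Fin n → ℝ} (h : ∀ i, x i ≤ y i) (t : ℕ) :
    runningMax x t ≤ runningMax y t := by
  induction t with
  | zero => exact le_rfl
  | succ t ih =>
    simp only [runningMax]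
    split
    · exact max_le_max ih (h _)
    · exact ih

theorem runningMax_congr {x y : Fin n → ℝ} (t : ℕ) (h : ∀ i : Fin n, i < t → x i = y i) :
    runningMax x t = runningMax y t := by
  induction t with
  | zero => rfl
  | succ t ih =>
    simp only [runningMax]
    rw [ih fun i hi => h i (by omega)]
    split
    · rw [h _ (by simp)]
    · rfl

theorem runningMax_le {x : Fin n → ℝ} {c : ℝ} (hc : 0 ≤ c) (h : ∀ i, x i ≤ c) (t : ℕ) :
    runningMax x t ≤ c := by
  induction t with
  | zero => exact hc
  | succ t ih =>
    simp only [runningMax]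
    split
    · exact max_le ih (h _)
    · exact ih

theorem runningMax_eq_sum (x : Fin n → ℝ) :
    runningMax x n = ∑ i : Fin n, (runningMax x (i + 1) - runningMax x i) := by
  rw [Fin.sum_univ_eq_sum_range (fun t => runningMax x (t + 1) - runningMax x t) n,
    sum_range_sub]
  simp [runningMax]

/-- If each `x R i` depends only on the part of the random set `R` before `i`, then leaving out the
indices in `R` preserves half of the expected maximum. -/
theorem sum_runningMax_le (x : Finset (Fin n) → Fin n → ℝ)
    (hx : ∀ R R' i, (∀ l, l < i → (l ∈ R ↔ l ∈ R')) → x R i = x R' i) (hx0 : ∀ R i, 0 ≤ x R i) :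
    ∑ R, runningMax (x R) n ≤
      2 * ∑ R, runningMax (fun i => if i ∈ R then 0 else x R i) n := by
  simp only [runningMax_eq_sum]
  rw [sum_comm, sum_comm (s := univ (α := Finset (Fin n))), mul_sum]
  refine sum_le_sum fun i _ => ?_
  have hmem : ∀ (R : Finset (Fin n)) (l : Fin n), l < i → (l ∈ symmDiff R {i} ↔ l ∈ R) := by
    intro R l hl
    simp [mem_symmDiff, hl.ne]
  refine (sum_le_two_mul_sum_not_mem (fun _ => i) _ (fun _ => rfl) ?_).trans ?_
  · intro R
    have h1 : ∀ l : Fin n, l < (i : ℕ) → x (symmDiff R {i}) l = x R l := fun l hl =>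
      hx _ _ _ fun k hk => hmem R k (hk.trans hl)
    simp only [runningMax_succ]
    rw [runningMax_congr _ h1, hx _ R i (hmem R)]
  · refine mul_le_mul_of_nonneg_left (sum_le_sum fun R _ => ?_) zero_le_two
    simp only [runningMax_succ]
    -- Deleting indices lowers the earlier maximum, so a kept index that sets a new record gains at
    -- least as much as before.
    have hle := runningMax_mono (x := fun l => if l ∈ R then 0 else x R l) (y := x R)
      (fun l => by split <;> simp [hx0]) i
    by_cases hi : i ∈ R
    · simp [hi]
    · simp only [hi, not_false_eq_true, if_true, if_false]
      rcases le_total (x R i) (runningMax (x R) i) with h | h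
      · rw [max_eq_left h, sub_self]
        exact sub_nonneg.2 (le_max_left _ _)
      · rw [max_eq_right h]
        exact (sub_le_sub_left hle _).trans (sub_le_sub_right (le_max_right _ _) _)

end RunningMax

/-! ### The single-item secretary problem -/

section SingleItem

variable {n : ℕ}

/-- With ties broken by index, candidate `i` beats all sampled candidates. -/
def BeatsSample (N S : Finset (Fin n)) (x : Fin n → ℝ) (i : Fin n) : Prop :=
  i ∈ N ∧ ∀ l ∈ N, l ∈ S → toLex (x l, l) < toLex (x i, i)

/-- `i` is the only unsampled candidate that beats all sampled candidates. -/
def IsSoleWinner (N S : Finset (Fin n)) (x : Fin n → ℝ) (i : Fin n) : Prop :=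
  i ∉ S ∧ BeatsSample N S x i ∧ ∀ l, l ∉ S → BeatsSample N S x l → l = i

open Classical in
/-- The value of the sole winner, if there is one. -/
noncomputable def soleWinnerValue (N S : Finset (Fin n)) (x : Fin n → ℝ) : ℝ :=
  ∑ i, if IsSoleWinner N S x i then x i else 0

theorem IsSoleWinner.le_value {N S : Finset (Fin n)} {x : Fin n → ℝ} {i : Fin n}
    (h : IsSoleWinner N S x i) (hx : ∀ l, 0 ≤ x l) : x i ≤ soleWinnerValue N S x := by
  classical
  unfold soleWinnerValue
  refine le_trans ?_ (single_le_sum (fun l _ => ?_) (mem_univ i))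
  · rw [if_pos h]
  · split
    · exact hx l
    · exact le_rfl

theorem soleWinnerValue_nonneg (N S : Finset (Fin n)) {x : Fin n → ℝ} (hx : ∀ l, 0 ≤ x l) :
    0 ≤ soleWinnerValue N S x := by
  classical
  unfold soleWinnerValue
  refine sum_nonneg fun l _ => ?_
  split
  · exact hx l
  · exact le_rfl

theorem exists_max_key {N : Finset (Fin n)} (hN : N.Nonempty) (x : Fin n → ℝ) :
    ∃ a ∈ N, ∀ l ∈ N, l ≠ a → toLex (x l, l) < toLex (x a, a) := by
  obtain ⟨a, ha, hmax⟩ := exists_max_image N (fun l => toLex (x l, l)) hN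
  refine ⟨a, ha, fun l hl hla => lt_of_le_of_ne (hmax l hl) fun h => hla ?_⟩
  exact congrArg (fun z => (ofLex z).2) h

theorem le_of_key_lt {x : Fin n → ℝ} {l a : Fin n} (h : toLex (x l, l) < toLex (x a, a)) :
    x l ≤ x a := by
  rcases Prod.Lex.toLex_lt_toLex.1 h with h | h
  · exact h.le
  · exact h.1.le

/-- If the values depend only on the part of the random sample `S` outside the candidate set `N`,
then the expected value of the sole winner is at least a quarter of the expected maximum. -/
theorem sum_max_le_four_mul_soleWinnerValue (N : Finset (Fin n))
    (x : Finset (Fin n) → Fin n → ℝ)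
    (hx : ∀ S S', S \ N = S' \ N → x S = x S') (hx0 : ∀ S i, 0 ≤ x S i) :
    ∑ S, runningMax (fun i => if i ∈ N then x S i else 0) n ≤
      4 * ∑ S, soleWinnerValue N S (x S) := by
  rcases N.eq_empty_or_nonempty with rfl | hN
  · refine le_trans (sum_nonpos fun S _ => runningMax_le le_rfl (by simp) n) ?_
    exact mul_nonneg (by norm_num) (sum_nonneg fun S _ => soleWinnerValue_nonneg _ _ (hx0 S))
  choose top htop hmax using fun S => exists_max_key hN (x S)
  have hdiff : ∀ (S : Finset (Fin n)) (a : Fin n), a ∈ N → symmDiff S {a} \ N = S \ N := by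
    intro S a ha
    ext l
    by_cases hl : l = a
    · subst hl; simp [ha]
    · simp [mem_symmDiff, hl]
  -- Computing the top candidate from `S \ N` makes it visibly invariant under toggling members of
  -- `N`.
  let e : Finset (Fin n) → Fin n := fun S => top (S \ N)
  have hxN : ∀ S, x (S \ N) = x S := fun S => hx _ _ (by simp)
  have heN : ∀ S, e S ∈ N := fun S => htop _
  have hemax : ∀ S, ∀ l ∈ N, l ≠ e S → toLex (x S l, l) < toLex (x S (e S), e S) := by
    intro S l hl hne
    have := hmax (S \ N) l hl hne
    rwa [hxN] at this
  have he : ∀ S a, a ∈ N → e (symmDiff S {a}) = e S := fun S a ha => by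
    simp only [e, hdiff S a ha]
  have hxa : ∀ S a, a ∈ N → x (symmDiff S {a}) = x S := fun S a ha => hx _ _ (hdiff S a ha)
  have h1 : ∑ S, runningMax (fun i => if i ∈ N then x S i else 0) n ≤ ∑ S, x S (e S) := by
    refine sum_le_sum fun S _ => runningMax_le (hx0 _ _) (fun i => ?_) n
    split
    · rename_i hi
      by_cases hie : i = e S
      · rw [← hie]
      · exact le_of_key_lt (hemax S i hi hie)
    · exact hx0 _ _
  have h2 : ∑ S, x S (e S) ≤ 2 * ∑ S, (if e S ∉ S then x S (e S) else 0) :=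
    sum_le_two_mul_sum_not_mem e (fun S => x S (e S)) (fun S => he S _ (heN S))
      (fun S => by simp only [he S _ (heN S), hxa S _ (heN S)])
  have h3 : ∑ S, (if e S ∉ S then x S (e S) else 0) ≤ 2 * ∑ S, soleWinnerValue N S (x S) := by
    -- With at least two candidates, toggling the runner-up `f S` affects neither `e S` nor its
    -- membership in `S`, which costs a second factor 2. A lone candidate needs only to be
    -- unsampled.
    by_cases hnt : N.Nontrivial
    · have hne : ∀ S, (N.erase (e S)).Nonempty := fun S => by
        obtain ⟨b, hb, hbe⟩ := hnt.exists_ne (e S)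
        exact ⟨b, mem_erase.2 ⟨hbe, hb⟩⟩
      choose snd hsnd hsmax using fun S => exists_max_key (hne (S \ N)) (x (S \ N))
      let f : Finset (Fin n) → Fin n := fun S => snd (S \ N)
      have heS : ∀ S, e (S \ N) = e S := fun S => by simp [e]
      have hfN : ∀ S, f S ∈ N := fun S => mem_of_mem_erase (hsnd _)
      have hfe : ∀ S, f S ≠ e S := fun S => by
        have := ne_of_mem_erase (hsnd (S \ N))
        simpa [e, f] using this
      have hfmax : ∀ S, ∀ l ∈ N, l ≠ e S → l ≠ f S → toLex (x S l, l) < toLex (x S (f S), f S) := by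
        intro S l hl hne hnf
        have := hsmax (S \ N) l (mem_erase.2 ⟨by simpa [heS] using hne, hl⟩)
          (by simpa [f] using hnf)
        simpa [hxN, f] using this
      have hf : ∀ S, f (symmDiff S {f S}) = f S := fun S => by
        have := hdiff S _ (hfN S)
        simp only [f] at this ⊢
        rw [this]
      refine (sum_le_two_mul_sum_mem f _ hf fun S => ?_).trans ?_
      · rw [he S _ (hfN S), hxa S _ (hfN S)]
        simp [mem_symmDiff, (hfe S).symm]
      · refine mul_le_mul_of_nonneg_left (sum_le_sum fun S _ => ?_) zero_le_two
        by_cases h : f S ∈ S ∧ e S ∉ S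
        · rw [if_pos h.1, if_pos h.2]
          refine IsSoleWinner.le_value ⟨h.2, ⟨heN S, fun l hl hlS => ?_⟩, fun l hlS hl => ?_⟩ (hx0 S)
          · exact hemax S l hl fun hle => h.2 (hle ▸ hlS)
          · by_contra hle
            -- The sampled runner-up blocks everyone but the top candidate.
            have h5 := hl.2 (f S) (hfN S) h.1
            exact lt_asymm h5 (hfmax S l hl.1 hle fun hlf => hlS (hlf ▸ h.1))
        · refine le_trans (le_of_eq ?_) (soleWinnerValue_nonneg _ _ (hx0 S))
          by_cases hf : f S ∈ S
          · have : e S ∈ S := by_contra fun he => h ⟨hf, he⟩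
            simp [this]
          · simp [hf]
    · have hs : ∀ S, ∀ l ∈ N, l = e S := fun S l hl =>
        by_contra fun hne => hnt ⟨l, hl, e S, heN S, hne⟩
      refine le_trans (sum_le_sum fun S _ => ?_)
        (le_mul_of_one_le_left (sum_nonneg fun S _ => soleWinnerValue_nonneg _ _ (hx0 S))
          one_le_two)
      split
      · rename_i h
        refine IsSoleWinner.le_value ⟨h, ⟨heN S, fun l hl hlS => ?_⟩, fun l _ hl => hs S l hl.1⟩
          (hx0 S)
        exact absurd (hs S l hl ▸ hlS) h
      · exact soleWinnerValue_nonneg _ _ (hx0 S)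
  linarith

end SingleItem

/-! ### Additive supports and demand -/

section Valuations

variable {m : ℕ}

theorem Valuation.IsXOS.exists_supporting {v : Valuation m} (hv : v.IsXOS)
    (D : Finset (Fin m)) :
    ∃ a : Fin m → ℝ, (∀ j, 0 ≤ a j) ∧ ∑ j ∈ D, a j = v.val D ∧ ∀ B, ∑ j ∈ B, a j ≤ v.val B := by
  obtain ⟨k, a, ha, hmax⟩ := hv
  obtain ⟨l, hl⟩ := (hmax D).1
  exact ⟨a l, ha l, hl, fun B => (hmax B).2 ⟨l, rfl⟩⟩

/-- Adding the items of `D` one at a time, the successive marginal values form the support. -/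
theorem Valuation.IsSubmodular.exists_supporting {v : Valuation m} (hv : v.IsSubmodular)
    (D : Finset (Fin m)) :
    ∃ a : Fin m → ℝ, (∀ j, 0 ≤ a j) ∧ ∑ j ∈ D, a j = v.val D ∧ ∀ B, ∑ j ∈ B, a j ≤ v.val B := by
  -- Vanishing outside `D` is carried along so that the weight of `B` reduces to that of `B ∩ D`.
  suffices h : ∃ a : Fin m → ℝ, (∀ j, 0 ≤ a j) ∧ (∀ j, j ∉ D → a j = 0) ∧
      ∑ j ∈ D, a j = v.val D ∧ ∀ B, ∑ j ∈ B, a j ≤ v.val B by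
    obtain ⟨a, h1, -, h2⟩ := h
    exact ⟨a, h1, h2⟩
  induction D using Finset.induction_on with
  | empty =>
    refine ⟨0, by simp, by simp, by simp [v.val_empty], fun B => ?_⟩
    simpa [v.val_empty] using v.mono (empty_subset B)
  | insert j D hj ih =>
    obtain ⟨a, h0, hD, hsum, hB⟩ := ih
    have hins : ∀ B, j ∉ B → ∑ l ∈ B, Function.update a j (v.val (insert j D) - v.val D) l =
        ∑ l ∈ B, a l := fun B hjB => sum_congr rfl fun l hl => by
      rw [Function.update_of_ne]
      rintro rfl
      exact hjB hl
    refine ⟨Function.update a j (v.val (insert j D) - v.val D), fun l => ?_, fun l hl => ?_, ?_,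
      fun B => ?_⟩
    · by_cases h : l = j
      · subst h
        simpa using v.mono (subset_insert l D)
      · simpa [h] using h0 l
    · rw [mem_insert, not_or] at hl
      rw [Function.update_of_ne hl.1]
      exact hD l hl.2
    · rw [sum_insert hj, hins D hj, hsum]
      simp
    · by_cases hjB : j ∈ B
      · have hsub : insert j (B ∩ D) ⊆ B :=
          insert_subset hjB inter_subset_left
        have hBD : ∑ l ∈ B.erase j, a l = ∑ l ∈ B ∩ D, a l := by
          refine (sum_subset (fun l hl => ?_) fun l _ hl => ?_).symm
          · rw [mem_inter] at hl
            exact mem_erase.2 ⟨fun h => hj (h ▸ hl.2), hl.1⟩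
          · refine hD l fun h => hl ?_
            rename_i hlB
            exact mem_inter.2 ⟨mem_of_mem_erase hlB, h⟩
        rw [← add_sum_erase B _ hjB, hins _ (notMem_erase j B), Function.update_self, hBD]
        -- The new weight, the marginal of `j` at `D`, is at most its marginal at `B ∩ D`.
        linarith [hv (B ∩ D) D inter_subset_right j hj, v.mono hsub, hB (B ∩ D)]
      · rw [hins B hjB]
        exact hB B

/-- `w` is an additive lower bound on `v` such that raising the prices `p` to `max p w` pays for
the utility of `v` at the prices `p`. -/
structure IsDemandSupport (v : Valuation m) (p w : Fin m → ℝ) : Prop where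
  nonneg : ∀ j, 0 ≤ w j
  sum_le : ∀ B, ∑ j ∈ B, w j ≤ v.val B
  utility_le : ∀ O, v.val O - ∑ j ∈ O, p j ≤ ∑ j, (max (p j) (w j) - p j)

/-- Support a utility-maximizing bundle `D` at prices `p`: the excess of the support over `p`,
summed over `D`, is exactly the maximal utility. -/
theorem exists_isDemandSupport {v : Valuation m} (hv : v.IsSubmodular ∨ v.IsXOS)
    (p : Fin m → ℝ) : ∃ w, IsDemandSupport v p w := by
  obtain ⟨D, -, hD⟩ := exists_max_image (univ : Finset (Finset (Fin m)))
    (fun D => v.val D - ∑ j ∈ D, p j) univ_nonempty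
  obtain ⟨a, h0, hsum, hB⟩ : ∃ a : Fin m → ℝ, (∀ j, 0 ≤ a j) ∧ ∑ j ∈ D, a j = v.val D ∧
      ∀ B, ∑ j ∈ B, a j ≤ v.val B :=
    hv.elim (fun h => h.exists_supporting D) fun h => h.exists_supporting D
  refine ⟨fun j => if j ∈ D then a j else 0, fun j => ?_, fun B => ?_, fun O => ?_⟩
  · split
    · exact h0 j
    · exact le_rfl
  · refine (sum_le_sum fun j _ => ?_).trans (hB B)
    split
    · exact le_rfl
    · exact h0 j
  · calc v.val O - ∑ j ∈ O, p j ≤ v.val D - ∑ j ∈ D, p j := hD O (mem_univ O)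
      _ = ∑ j ∈ D, (a j - p j) := by rw [sum_sub_distrib, hsum]
      _ ≤ ∑ j ∈ D, (max (p j) (if j ∈ D then a j else 0) - p j) :=
        sum_le_sum fun j hj => by
          rw [if_pos hj]
          exact sub_le_sub_right (le_max_right _ _) _
      _ ≤ _ := sum_le_sum_of_subset_of_nonneg (subset_univ D) fun j _ _ =>
        sub_nonneg.2 (le_max_left _ _)

open Classical in
/-- A choice of the additive function of `IsDemandSupport`, or `0` if there is none. -/
noncomputable def demandSupport (v : Valuation m) (p : Fin m → ℝ) : Fin m → ℝ :=
  if h : ∃ w, IsDemandSupport v p w then h.choose else 0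

theorem isDemandSupport_demandSupport {v : Valuation m} (hv : v.IsSubmodular ∨ v.IsXOS)
    (p : Fin m → ℝ) : IsDemandSupport v p (demandSupport v p) := by
  rw [demandSupport, dif_pos (exists_isDemandSupport hv p)]
  exact (exists_isDemandSupport hv p).choose_spec

end Valuations

/-! ### Prices raised by successive buyers -/

section Prices

variable {n m : ℕ}

/-- Item prices after the observed buyers with index `< t` have successively raised them. -/
noncomputable def price (obs : Fin n → Option (Valuation m)) : ℕ → Fin m → ℝ
  | 0 => 0
  | t + 1 => if h : t < n then
      (obs ⟨t, h⟩).elim (price obs t) fun v => price obs t ⊔ demandSupport v (price obs t)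
    else price obs t

/-- The additive valuation by which buyer `i` with valuation `u` competes for the items. -/
noncomputable def bid (obs : Fin n → Option (Valuation m)) (i : Fin n) (u : Valuation m) :
    Fin m → ℝ :=
  demandSupport u (price obs i)

theorem price_congr {obs obs' : Fin n → Option (Valuation m)} (t : ℕ)
    (h : ∀ i : Fin n, i < t → obs i = obs' i) : price obs t = price obs' t := by
  induction t with
  | zero => rfl
  | succ t ih =>
    simp only [price]
    rw [ih fun i hi => h i (by omega)]
    split
    · rw [h _ (by simp)]
    · rfl

theorem price_succ_of_mem (v : Fin n → Valuation m) {H : Finset (Fin n)} {i : Fin n}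
    (hi : i ∈ H) : price (observe v H) (i + 1) =
      price (observe v H) i ⊔ bid (observe v H) i (v i) := by
  simp [price, observe, hi, bid]

theorem price_succ_of_not_mem (v : Fin n → Valuation m) {H : Finset (Fin n)} {i : Fin n}
    (hi : i ∉ H) : price (observe v H) (i + 1) = price (observe v H) i := by
  simp [price, observe, hi]

theorem monotone_price (obs : Fin n → Option (Valuation m)) : Monotone (price obs) := by
  refine monotone_nat_of_le_succ fun t => ?_
  simp only [price]
  split
  · cases obs _
    · exact le_rfl
    · exact le_sup_left
  · exact le_rfl

theorem price_nonneg (obs : Fin n → Option (Valuation m)) (t : ℕ) (j : Fin m) :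
    0 ≤ price obs t j :=
  monotone_price obs (Nat.zero_le t) j

theorem price_le_runningMax (v : Fin n → Valuation m) (H : Finset (Fin n)) (j : Fin m) (t : ℕ) :
    price (observe v H) t j ≤ runningMax (fun i => bid (observe v H) i (v i) j) t := by
  induction t with
  | zero => exact le_rfl
  | succ t ih =>
    by_cases ht : t < n
    · have h1 := runningMax_succ (fun i => bid (observe v H) i (v i) j) ⟨t, ht⟩
      dsimp only at h1
      rw [h1]
      by_cases hi : (⟨t, ht⟩ : Fin n) ∈ H
      · have h2 := price_succ_of_mem v hi
        dsimp only at h2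
        rw [h2]
        exact max_le_max ih le_rfl
      · have h2 := price_succ_of_not_mem v hi
        dsimp only at h2
        rw [h2]
        exact ih.trans (le_max_left _ _)
    · simpa [price, runningMax, ht] using ih

/-- The final prices cover half of the optimal welfare of the buyers that raised them. -/
theorem sum_val_le_two_mul_sum_price {v : Fin n → Valuation m}
    (hv : ∀ i, (v i).IsSubmodular ∨ (v i).IsXOS) (H : Finset (Fin n)) (A : Allocation n m) :
    ∑ i ∈ H, (v i).val (A.1 i) ≤ 2 * ∑ j, price (observe v H) n j := by
  -- Value is price paid plus utility: the first part is bounded by final prices, the second by the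
  -- price rise this buyer causes. Disjointness of the bundles and telescoping then each give one
  -- copy of the total price.
  have h1 : ∀ i, (if i ∈ H then (v i).val (A.1 i) else 0) ≤
      ∑ j ∈ A.1 i, price (observe v H) n j +
        ∑ j, (price (observe v H) (i + 1) j - price (observe v H) i j) := by
    intro i
    have h0 : ∑ j ∈ A.1 i, price (observe v H) i j ≤ ∑ j ∈ A.1 i, price (observe v H) n j :=
      sum_le_sum fun j _ => monotone_price _ i.2.le j
    split
    · rename_i hi
      rw [price_succ_of_mem v hi]
      have := (isDemandSupport_demandSupport (hv i) (price (observe v H) i)).utility_le (A.1 i)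
      simp only [Pi.sup_apply, bid]
      linarith
    · exact add_nonneg (sum_nonneg fun j _ => price_nonneg _ _ _)
        (sum_nonneg fun j _ => sub_nonneg.2 (monotone_price _ (Nat.le_succ _) j))
  have h2 : ∑ i, ∑ j ∈ A.1 i, price (observe v H) n j ≤ ∑ j, price (observe v H) n j := by
    rw [← sum_biUnion fun i _ l _ hil => A.2 i l hil]
    exact sum_le_sum_of_subset_of_nonneg (subset_univ _) fun j _ _ => price_nonneg _ _ _
  have h3 : ∑ i : Fin n, ∑ j, (price (observe v H) (i + 1) j - price (observe v H) i j) =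
      ∑ j, price (observe v H) n j := by
    rw [sum_comm]
    refine sum_congr rfl fun j _ => ?_
    rw [Fin.sum_univ_eq_sum_range
      (fun t => price (observe v H) (t + 1) j - price (observe v H) t j) n,
      sum_range_sub (fun t => price (observe v H) t j)]
    simp [price]
  have h4 := sum_le_sum fun i (_ : i ∈ univ) => h1 i
  rw [sum_add_distrib, h3, sum_ite_mem, univ_inter] at h4
  linarith

end Prices

/-! ### The split-sample algorithm and its competitive ratio -/

section TheAlgorithm

variable {n m : ℕ}

/-- The part of the observations in `R`. -/
def restrictObs (R : Finset (Fin n)) (obs : Fin n → Option (Valuation m)) :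
    Fin n → Option (Valuation m) :=
  fun i => if i ∈ R then obs i else none

theorem restrictObs_observe (v : Fin n → Valuation m) (R S : Finset (Fin n)) :
    restrictObs R (observe v S) = observe v (R ∩ S) := by
  funext i
  by_cases h : i ∈ R <;> simp [restrictObs, observe, h]

open Classical in
/-- The seed consists of the sample size and a uniformly random set `R`. The sampled buyers in `R`
determine prices and thereby the additive bids of all buyers; unsampled buyers in `R` get nothing.
An unsampled buyer outside `R` requests the items for which it outbids all sampled buyers outside
`R`. -/
noncomputable def splitSampleAlgorithm (n m : ℕ) : Algorithm n m where
  Seed := Fin (n + 1) × Finset (Fin n)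
  -- A binomial sample size, independent of a uniform `R`.
  prob ω := n.choose ω.1 / 2 ^ n / 2 ^ n
  prob_nonneg ω := by positivity
  prob_sum := by
    rw [Fintype.sum_prod_type]
    simp only [sum_const, card_univ, Fintype.card_finset, Fintype.card_fin, nsmul_eq_mul]
    rw [Fin.sum_univ_eq_sum_range
      (fun k => ((2 ^ n : ℕ) : ℝ) * ((n.choose k : ℝ) / 2 ^ n / 2 ^ n)) (n + 1), ← mul_sum,
      ← sum_div, ← sum_div, ← Nat.cast_sum, Nat.sum_range_choose]
    push_cast
    field_simp
  sampleSize ω := ω.1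
  sampleSize_le ω := Nat.lt_succ_iff.1 ω.1.2
  request ω obs _ x := univ.filter fun j => x.1 ∉ ω.2 ∧ ∀ l, l ∉ ω.2 → ∀ u, obs l = some u →
    toLex (bid (restrictObs ω.2 obs) l u j, l) < toLex (bid (restrictObs ω.2 obs) x.1 x.2 j, x.1)

theorem samplesHalf_splitSampleAlgorithm (n m : ℕ) : SamplesHalf (splitSampleAlgorithm n m) := by
  intro k
  change ∑ ω : Fin (n + 1) × Finset (Fin n),
    (if (ω.1 : ℕ) = k then (n.choose ω.1 : ℝ) / 2 ^ n / 2 ^ n else 0) = _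
  rw [Fintype.sum_prod_type]
  simp only [sum_const, card_univ, Fintype.card_finset, Fintype.card_fin, nsmul_eq_mul]
  rw [Fin.sum_univ_eq_sum_range (fun l => ((2 ^ n : ℕ) : ℝ) *
    (if l = k then (n.choose l : ℝ) / 2 ^ n / 2 ^ n else 0)) (n + 1), ← mul_sum, sum_ite_eq']
  split
  · push_cast
    field_simp
  · rename_i h
    -- Sizes above `n` have probability zero on both sides.
    rw [Nat.choose_eq_zero_of_lt (by simpa using h)]
    simp

theorem mem_request_iff (v : Fin n → Valuation m) (ω : (splitSampleAlgorithm n m).Seed)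
    (S : Finset (Fin n)) (past : List (Arrival n m)) (i : Fin n) (j : Fin m) :
    j ∈ (splitSampleAlgorithm n m).request ω (observe v S) past (i, v i) ↔
      BeatsSample ω.2ᶜ S (fun l => bid (observe v (ω.2 ∩ S)) l (v l) j) i := by
  simp [splitSampleAlgorithm, BeatsSample, restrictObs_observe, observe]

theorem exists_of_mem_taken (v : Fin n → Valuation m) (ω : (splitSampleAlgorithm n m).Seed)
    (S : Finset (Fin n)) (j : Fin m) (L : List (Fin n))
    (hj : j ∈ (splitSampleAlgorithm n m).taken ω (observe v S) (L.map fun i => (i, v i))) :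
    ∃ i ∈ L, BeatsSample ω.2ᶜ S (fun l => bid (observe v (ω.2 ∩ S)) l (v l) j) i := by
  induction L with
  | nil => simp [Algorithm.taken] at hj
  | cons i L ih =>
    rw [List.map_cons, Algorithm.taken, mem_union, mem_request_iff] at hj
    rcases hj with hj | hj
    · obtain ⟨l, hl, h⟩ := ih hj
      exact ⟨l, List.mem_cons_of_mem _ hl, h⟩
    · exact ⟨i, List.mem_cons_self, hj⟩

-- The list is most recent first, so the tail holds the earlier arrivals. An item's sole winner
-- finds it still available, and by monotonicity of its additive bid it earns at least its bids on
-- all such items.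
open Classical in
theorem le_welfare {v : Fin n → Valuation m} (hv : ∀ i, (v i).IsSubmodular ∨ (v i).IsXOS)
    (ω : (splitSampleAlgorithm n m).Seed) (S : Finset (Fin n)) (L : List (Fin n))
    (hL : L.Nodup) (hS : ∀ i ∈ L, i ∉ S) :
    (L.map fun i => ∑ j, if IsSoleWinner ω.2ᶜ S
        (fun l => bid (observe v (ω.2 ∩ S)) l (v l) j) i
      then bid (observe v (ω.2 ∩ S)) i (v i) j else 0).sum ≤
      (splitSampleAlgorithm n m).welfare ω (observe v S) (L.map fun i => (i, v i)) := by
  induction L with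
  | nil => simp [Algorithm.welfare]
  | cons i L ih =>
    rw [List.nodup_cons] at hL
    simp only [List.map_cons, List.sum_cons, Algorithm.welfare]
    rw [add_comm]
    refine add_le_add (ih hL.2 fun l hl => hS l (List.mem_cons_of_mem _ hl)) ?_
    have hsup := isDemandSupport_demandSupport (hv i) (price (observe v (ω.2 ∩ S)) i)
    refine le_trans ?_ (hsup.sum_le _)
    rw [← sum_filter]
    refine sum_le_sum_of_subset_of_nonneg (fun j hj => ?_) fun j _ _ => hsup.nonneg j
    have hw := (mem_filter.1 hj).2
    refine mem_sdiff.2 ⟨(mem_request_iff v ω S _ i j).2 hw.2.1, fun ht => ?_⟩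
    obtain ⟨l, hl, hb⟩ := exists_of_mem_taken v ω S j L ht
    exact hL.1 (hw.2.2 l (hS l (List.mem_cons_of_mem _ hl)) hb ▸ hl)

theorem sum_soleWinnerValue_le_welfare {v : Fin n → Valuation m}
    (hv : ∀ i, (v i).IsSubmodular ∨ (v i).IsXOS)
    (ω : (splitSampleAlgorithm n m).Seed) (S : Finset (Fin n)) (L : List (Fin n))
    (hL : IsArrivalOrder S L) :
    ∑ j, soleWinnerValue ω.2ᶜ S (fun l => bid (observe v (ω.2 ∩ S)) l (v l) j) ≤
      (splitSampleAlgorithm n m).welfare ω (observe v S) (L.map fun i => (i, v i)).reverse := by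
  classical
  rw [← List.map_reverse]
  refine le_trans (le_of_eq ?_) (le_welfare hv ω S L.reverse (List.nodup_reverse.2 hL.1)
    fun i hi => (hL.2 i).1 (List.mem_reverse.1 hi))
  rw [← List.sum_toFinset _ (List.nodup_reverse.2 hL.1)]
  simp only [soleWinnerValue]
  rw [sum_comm]
  refine (sum_subset (subset_univ _) fun i _ hi => sum_eq_zero fun j _ => if_neg fun h => ?_).symm
  exact hi (by simpa using (hL.2 i).2 h.1)

/-- A uniform set of binomial size is a uniform subset, so the factor `n.choose k` cancels and the
average runs over all pairs `R`, `S`. -/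
theorem sum_le_expectedWelfare {v : Fin n → Valuation m}
    (hv : ∀ i, (v i).IsSubmodular ∨ (v i).IsXOS)
    (order : (splitSampleAlgorithm n m).Seed → Finset (Fin n) → List (Fin n))
    (horder : ∀ ω S, IsArrivalOrder S (order ω S)) :
    (∑ R : Finset (Fin n), ∑ S : Finset (Fin n), ∑ j,
      soleWinnerValue Rᶜ S (fun l => bid (observe v (R ∩ S)) l (v l) j)) / (2 ^ n * 2 ^ n) ≤
      expectedWelfare (splitSampleAlgorithm n m) v order := by
  set g : Finset (Fin n) → Finset (Fin n) → ℝ := fun R S => ∑ j,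
    soleWinnerValue Rᶜ S (fun l => bid (observe v (R ∩ S)) l (v l) j)
  have h1 : ∑ ω : Fin (n + 1) × Finset (Fin n),
      (∑ S ∈ powersetCard ω.1 univ, g ω.2 S) / (2 ^ n * 2 ^ n) ≤
      expectedWelfare (splitSampleAlgorithm n m) v order := by
    refine sum_le_sum fun (ω : Fin (n + 1) × Finset (Fin n)) _ => ?_
    have hc : (0 : ℝ) < n.choose ω.1 :=
      Nat.cast_pos.2 (Nat.choose_pos (Nat.lt_succ_iff.1 ω.1.2))
    change _ ≤ (n.choose ω.1 : ℝ) / 2 ^ n / 2 ^ n *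
      ((∑ S ∈ powersetCard (ω.1 : ℕ) univ, _) / (n.choose ω.1 : ℝ))
    have hle : ∑ S ∈ powersetCard (ω.1 : ℕ) univ, g ω.2 S ≤
        ∑ S ∈ powersetCard (ω.1 : ℕ) univ, (splitSampleAlgorithm n m).welfare ω (observe v S)
          ((order ω S).map fun i => (i, v i)).reverse :=
      sum_le_sum fun S _ => sum_soleWinnerValue_le_welfare hv ω S _ (horder ω S)
    refine (div_le_div_of_nonneg_right hle (by positivity)).trans (le_of_eq ?_)
    field_simp
  refine le_trans (le_of_eq ?_) h1
  rw [← sum_div, Fintype.sum_prod_type_right]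
  refine congrArg (· / (2 ^ n * 2 ^ n : ℝ)) (sum_congr rfl fun R _ => ?_)
  rw [Fin.sum_univ_eq_sum_range (fun k => ∑ S ∈ powersetCard k univ, g R S) (n + 1),
    ← powerset_univ, sum_powerset, card_univ, Fintype.card_fin]

/-- A bid uses only the prices formed before its index; this is the independence that toggling `i`
in `R` relies on. -/
theorem bid_congr (v : Fin n → Valuation m) {H H' : Finset (Fin n)} {i : Fin n}
    (h : ∀ l, l < i → (l ∈ H ↔ l ∈ H')) :
    bid (observe v H) i (v i) = bid (observe v H') i (v i) := by
  unfold bid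
  rw [price_congr (obs' := observe v H') i fun l hl => by simp [observe, h l hl]]

theorem sum_val_le_soleWinnerValue {v : Fin n → Valuation m}
    (hv : ∀ i, (v i).IsSubmodular ∨ (v i).IsXOS) (A : Allocation n m) :
    (2 ^ n * 2 ^ n) * ∑ i, (v i).val (A.1 i) ≤
      64 * ∑ R : Finset (Fin n), ∑ S : Finset (Fin n), ∑ j,
        soleWinnerValue Rᶜ S (fun l => bid (observe v (R ∩ S)) l (v l) j) := by
  have hbid : ∀ (H : Finset (Fin n)) i j, 0 ≤ bid (observe v H) i (v i) j := fun H i j =>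
    (isDemandSupport_demandSupport (hv i) _).nonneg j
  have h1 : (2 ^ n * 2 ^ n) * ∑ i, (v i).val (A.1 i) ≤
      4 * ∑ R : Finset (Fin n), ∑ S, ∑ i ∈ R ∩ S, (v i).val (A.1 i) := by
    have key : ∀ i, (2 ^ n * 2 ^ n) * (v i).val (A.1 i) ≤
        4 * ∑ R : Finset (Fin n), ∑ S : Finset (Fin n),
          (if i ∈ R ∩ S then (v i).val (A.1 i) else 0) := by
      intro i
      have hS := sum_le_two_mul_sum_mem (fun _ : Finset (Fin n) => i)
        (fun _ => (v i).val (A.1 i)) (fun _ => rfl) fun _ => rfl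
      have hR := sum_le_two_mul_sum_mem (fun _ : Finset (Fin n) => i)
        (fun _ => ∑ S : Finset (Fin n), (if i ∈ S then (v i).val (A.1 i) else 0))
        (fun _ => rfl) fun _ => rfl
      have he : ∀ R : Finset (Fin n), (if i ∈ R then ∑ S : Finset (Fin n),
          (if i ∈ S then (v i).val (A.1 i) else 0) else 0) =
          ∑ S : Finset (Fin n), (if i ∈ R ∩ S then (v i).val (A.1 i) else 0) := by
        intro R
        by_cases hi : i ∈ R <;> simp [hi]
      simp only [he] at hR
      simp only [sum_const, card_univ, Fintype.card_finset, Fintype.card_fin, nsmul_eq_mul,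
        Nat.cast_pow, Nat.cast_ofNat] at hS hR
      -- Scaling by the number of sets `R` lets the two halvings chain.
      have := mul_le_mul_of_nonneg_left hS (show (0 : ℝ) ≤ 2 ^ n by positivity)
      linarith
    rw [mul_sum]
    refine (sum_le_sum fun i _ => key i).trans (le_of_eq ?_)
    rw [← mul_sum, sum_comm]
    congr 1
    refine sum_congr rfl fun R _ => ?_
    rw [sum_comm]
    refine sum_congr rfl fun S _ => ?_
    rw [sum_ite_mem, univ_inter]
  have h2 : ∑ R : Finset (Fin n), ∑ S, ∑ i ∈ R ∩ S, (v i).val (A.1 i) ≤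
      2 * ∑ R : Finset (Fin n), ∑ S : Finset (Fin n), ∑ j,
        runningMax (fun i => bid (observe v (R ∩ S)) i (v i) j) n := by
    simp only [mul_sum]
    refine sum_le_sum fun R _ => sum_le_sum fun S _ =>
      (sum_val_le_two_mul_sum_price hv _ A).trans ?_
    rw [mul_sum]
    exact sum_le_sum fun j _ => mul_le_mul_of_nonneg_left (price_le_runningMax v _ j n) zero_le_two
  have h3 : ∀ (j : Fin m) (S : Finset (Fin n)),
      ∑ R : Finset (Fin n), runningMax (fun i => bid (observe v (R ∩ S)) i (v i) j) n ≤
      2 * ∑ R : Finset (Fin n),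
        runningMax (fun i => if i ∈ R then 0 else bid (observe v (R ∩ S)) i (v i) j) n :=
    fun j S => sum_runningMax_le (fun R i => bid (observe v (R ∩ S)) i (v i) j)
      (fun R R' i h => by
        rw [bid_congr v (H' := R' ∩ S) fun l hl => by simp [h l hl]])
      fun R i => hbid _ _ _
  have h4 : ∀ (j : Fin m) (R : Finset (Fin n)),
      ∑ S : Finset (Fin n),
        runningMax (fun i => if i ∈ R then 0 else bid (observe v (R ∩ S)) i (v i) j) n ≤
      4 * ∑ S : Finset (Fin n),
        soleWinnerValue Rᶜ S (fun l => bid (observe v (R ∩ S)) l (v l) j) := by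
    intro j R
    have := sum_max_le_four_mul_soleWinnerValue Rᶜ
      -- Prices see `S` only inside `R`, the complement of the candidate set.
      (fun S i => bid (observe v (R ∩ S)) i (v i) j) (fun S S' h => by
        rw [sdiff_compl, sdiff_compl] at h
        simp only [inf_eq_inter] at h
        rw [inter_comm R S, inter_comm R S', h]) fun S i => hbid _ _ _
    simpa only [mem_compl, ite_not] using this
  have h5 : ∑ R : Finset (Fin n), ∑ S : Finset (Fin n), ∑ j,
        runningMax (fun i => bid (observe v (R ∩ S)) i (v i) j) n ≤
      2 * ∑ R : Finset (Fin n), ∑ S : Finset (Fin n), ∑ j,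
        runningMax (fun i => if i ∈ R then 0 else bid (observe v (R ∩ S)) i (v i) j) n := by
    -- Here `S` must be fixed while `R` varies; the next bound fixes `R` instead.
    rw [sum_comm]
    conv_rhs => rw [sum_comm, mul_sum]
    refine sum_le_sum fun S _ => ?_
    rw [sum_comm]
    conv_rhs => rw [sum_comm, mul_sum]
    exact sum_le_sum fun j _ => h3 j S
  have h6 : ∑ R : Finset (Fin n), ∑ S : Finset (Fin n), ∑ j,
        runningMax (fun i => if i ∈ R then 0 else bid (observe v (R ∩ S)) i (v i) j) n ≤
      4 * ∑ R : Finset (Fin n), ∑ S : Finset (Fin n), ∑ j,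
        soleWinnerValue Rᶜ S (fun l => bid (observe v (R ∩ S)) l (v l) j) := by
    rw [mul_sum]
    refine sum_le_sum fun R _ => ?_
    rw [sum_comm]
    conv_rhs => rw [sum_comm, mul_sum]
    exact sum_le_sum fun j _ => h4 j R
  linarith

end TheAlgorithm

end OrderObliviousSecretary

theorem mainTheorem4 :
    ∃ α : ℝ, 1 ≤ α ∧
      ∃ alg : ∀ n m : ℕ, OrderObliviousSecretary.Algorithm n m,
        ∀ n m : ℕ, OrderObliviousSecretary.SamplesHalf (alg n m) ∧
          OrderObliviousSecretary.IsCompetitive (alg n m) α := by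
  refine ⟨64, by norm_num, OrderObliviousSecretary.splitSampleAlgorithm, fun n m =>
    ⟨OrderObliviousSecretary.samplesHalf_splitSampleAlgorithm n m, fun v hv order horder => ?_⟩⟩
  have : Nonempty (OrderObliviousSecretary.Allocation n m) :=
    ⟨⟨fun _ => ∅, fun _ _ _ => disjoint_bot_left⟩⟩
  refine ciSup_le fun A => ?_
  have h1 := OrderObliviousSecretary.sum_val_le_soleWinnerValue hv A
  have h2 := OrderObliviousSecretary.sum_le_expectedWelfare hv order horder
  rw [div_le_iff₀ (by positivity)] at h2
  have h3 : (0 : ℝ) < 2 ^ n * 2 ^ n := by positivity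
  refine le_of_mul_le_mul_left ?_ h3
  linarith
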